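/- Let $n\ge 1$ and let $X=(X_1,\dots,X_n)$ be a Gaussian random field on a probability space $(\Omega,\mathcal A,\mathbb P)$, i.e. every finite subcollection of the random variables $X_1,\dots,X_n$ has a (possibly degenerate, not necessarily centered) multivariate normal law. Let $\sigma_i\ge 0$ with $\operatorname{Var}(X_i)=\sigma_i^2$, let $\sigma_{(1)}\le\dots\le\sigma_{(n)}$ be the values $\sigma_1,\dots,\sigma_n$ in non-decreasing order, and set $$\bar\sigma_n=\frac{2+\sqrt{2\log n}}{\dfrac1{\sigma_{(1)}}+\max_{1\le k\le n}\dfrac{1+\sqrt{2\log k}}{\sigma_{(k)}}},$$ where $\bar\sigma_n=0$ if $\sigma_{(1)}=0$ (i.e. $1/0=+\infty$). Then $\bar\sigma_n\ge\sigma_{(1)}$, and for all $x\in\mathbb R^n$ and all $\varepsilon>0$, $$\mathbb P\{x\le X\le x+\varepsilon\mathbf 1\}\le\frac{12\left(2+\sqrt{2\log n}\right)\varepsilon}{\sqrt{\bar\sigma_n^2+\left(2+\sqrt{2\log n}\right)^2\varepsilon^2}},$$ where $\mathbf 1=(1,\dots,1)\in\mathbb R^n$ and the vector inequalities are understood element-wise.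 -/

import Mathlib

open MeasureTheory ProbabilityTheory

noncomputable section

namespace GaussianAntiConcentration

/-- The values `a 0, …, a (n - 1)` in non-decreasing order. The index `k : Fin n` is zero-based:
`orderStat a k` is the `(k + 1)`-st smallest value, counted with multiplicity. -/
def orderStat {n : ℕ} (a : Fin n → ℝ) (k : Fin n) : ℝ := a (Tuple.sort a k)

/-- The factor `2 + √(2 log n)`. -/
def logFactor (n : ℕ) : ℝ := 2 + √(2 * Real.log n)

/-- `1 / σ₍₁₎ + max_{1 ≤ k ≤ n} (1 + √(2 log k)) / σ₍ₖ₎`, for positive `σ₁, …, σₙ`.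
The zero-based index `k : Fin n` stands for the rank `k + 1`. -/
def rankedSum {n : ℕ} [NeZero n] (σ : Fin n → ℝ) : ℝ :=
  1 / orderStat σ 0 +
    Finset.univ.sup' Finset.univ_nonempty fun k : Fin n =>
      (1 + √(2 * Real.log ((k : ℕ) + 1 : ℝ))) / orderStat σ k

open Classical in
/-- `σ̄ₙ = (2 + √(2 log n)) / (1 / σ₍₁₎ + max_{1 ≤ k ≤ n} (1 + √(2 log k)) / σ₍ₖ₎)`.
If `σ₍₁₎ = 0` the denominator is `+∞` (as `1 / 0 = +∞`), so that `σ̄ₙ = 0`; this case is written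
out because real division by zero in Lean returns `0`. -/
def sigmaBar {n : ℕ} [NeZero n] (σ : Fin n → ℝ) : ℝ :=
  if orderStat σ 0 = 0 then 0 else logFactor n / rankedSum σ

end GaussianAntiConcentration

end

namespace GaussianAntiConcentration

open Real

/-! The event is an intersection over coordinates, so a single coordinate of largest deviation
`σ₍ₙ₎` suffices: its Gaussian density is at most `1 / σ₍ₙ₎`, so the probability `p` satisfies `p *
σ₍ₙ₎ ≤ ε`. Since `σ̄ₙ ≤ σ₍ₙ₎` (`sigmaBar_le_topOrderStat`), also `p * σ̄ₙ ≤ ε`. With `L = logFactor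
n`, combining this with `p ≤ 1` and `√(a² + b²) ≤ a + b` gives `p * √(σ̄ₙ² + L²ε²) ≤ ε + Lε`. Only
one-dimensional marginals enter; the dependence between coordinates plays no role. -/

lemma two_le_logFactor (n : ℕ) : 2 ≤ logFactor n := by
  unfold logFactor
  linarith [sqrt_nonneg (2 * log n)]

lemma monotone_orderStat {n : ℕ} (a : Fin n → ℝ) : Monotone (orderStat a) :=
  Tuple.monotone_sort a

/-- The largest of the order statistics. -/
noncomputable def topOrderStat {n : ℕ} [NeZero n] (a : Fin n → ℝ) : ℝ :=
  orderStat a ⟨n - 1, Nat.sub_one_lt (NeZero.ne n)⟩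

lemma orderStat_le_topOrderStat {n : ℕ} [NeZero n] (a : Fin n → ℝ) (k : Fin n) :
    orderStat a k ≤ topOrderStat a :=
  monotone_orderStat a (Fin.mk_le_mk.2 (Nat.le_sub_one_of_lt k.isLt))

lemma rankedSum_pos {n : ℕ} [NeZero n] {σ : Fin n → ℝ} (h0 : 0 < orderStat σ 0) :
    0 < rankedSum σ := by
  refine add_pos (one_div_pos.2 h0) ((Finset.lt_sup'_iff _).2 ⟨0, Finset.mem_univ _, ?_⟩)
  positivity

/-- Each term of the maximum grows when its rank is raised to `n` in the numerator and its
denominator lowered to `σ₍₁₎`. -/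
lemma rankedSum_le {n : ℕ} [NeZero n] {σ : Fin n → ℝ} (h0 : 0 < orderStat σ 0) :
    rankedSum σ ≤ logFactor n / orderStat σ 0 := by
  have h : (Finset.univ.sup' Finset.univ_nonempty fun k : Fin n =>
      (1 + √(2 * log ((k : ℕ) + 1 : ℝ))) / orderStat σ k) ≤ (1 + √(2 * log n)) / orderStat σ 0 := by
    refine Finset.sup'_le _ _ fun k _ => ?_
    have hk : ((k : ℕ) + 1 : ℝ) ≤ n := by exact_mod_cast k.isLt
    have hm : orderStat σ 0 ≤ orderStat σ k := monotone_orderStat σ (Fin.zero_le k)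
    gcongr
  calc rankedSum σ ≤ 1 / orderStat σ 0 + (1 + √(2 * log n)) / orderStat σ 0 := by
        unfold rankedSum; gcongr
    _ = logFactor n / orderStat σ 0 := by unfold logFactor; ring

/-- Keep only the term of rank `n` in the maximum and weaken `1 / σ₍₁₎` to `1 / σ₍ₙ₎`. -/
lemma le_rankedSum {n : ℕ} [NeZero n] {σ : Fin n → ℝ} (h0 : 0 < orderStat σ 0) :
    logFactor n / topOrderStat σ ≤ rankedSum σ := by
  have hn : (((n - 1 : ℕ) : ℝ) + 1) = n := by
    exact_mod_cast Nat.sub_add_cancel (NeZero.one_le (n := n))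
  have h : (1 + √(2 * log n)) / topOrderStat σ ≤
      Finset.univ.sup' Finset.univ_nonempty fun k : Fin n =>
        (1 + √(2 * log ((k : ℕ) + 1 : ℝ))) / orderStat σ k := by
    refine Finset.le_sup'_of_le _ (Finset.mem_univ ⟨n - 1, Nat.sub_one_lt (NeZero.ne n)⟩) ?_
    rw [hn, topOrderStat]
  have h1 : 1 / topOrderStat σ ≤ 1 / orderStat σ 0 :=
    one_div_le_one_div_of_le h0 (orderStat_le_topOrderStat σ 0)
  calc logFactor n / topOrderStat σ
      = 1 / topOrderStat σ + (1 + √(2 * log n)) / topOrderStat σ := by unfold logFactor; ring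
    _ ≤ rankedSum σ := add_le_add h1 h

lemma orderStat_zero_le_sigmaBar {n : ℕ} [NeZero n] {σ : Fin n → ℝ} (hσ : ∀ i, 0 ≤ σ i) :
    orderStat σ 0 ≤ sigmaBar σ := by
  unfold sigmaBar
  split_ifs with h
  · exact h.le
  · have h0 : 0 < orderStat σ 0 := (hσ _).lt_of_ne' h
    rw [le_div_iff₀ (rankedSum_pos h0), mul_comm]
    exact (le_div_iff₀ h0).1 (rankedSum_le h0)

lemma sigmaBar_le_topOrderStat {n : ℕ} [NeZero n] {σ : Fin n → ℝ} (hσ : ∀ i, 0 ≤ σ i) :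
    sigmaBar σ ≤ topOrderStat σ := by
  unfold sigmaBar
  split_ifs with h
  · exact hσ _
  · have h0 : 0 < orderStat σ 0 := (hσ _).lt_of_ne' h
    rw [div_le_iff₀ (rankedSum_pos h0), mul_comm]
    exact (div_le_iff₀ (h0.trans_le (orderStat_le_topOrderStat σ 0))).1 (le_rankedSum h0)

/-- The factor `1 / √(2π)` is discarded. The product form, unlike a quotient, stays meaningful for
`v = 0`. -/
lemma gaussianPDFReal_mul_sqrt_le_one (m : ℝ) (v : NNReal) (x : ℝ) :
    gaussianPDFReal m v x * √v ≤ 1 := by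
  rcases eq_or_ne v 0 with rfl | hv
  · simp
  have hv' : 0 < √(v : ℝ) := sqrt_pos.2 (by positivity)
  have hexp : exp (-(x - m) ^ 2 / (2 * v)) ≤ 1 :=
    exp_le_one_iff.2 (div_nonpos_of_nonpos_of_nonneg (by nlinarith [sq_nonneg (x - m)])
      (by positivity))
  have hsqrt : √(v : ℝ) ≤ √(2 * π * v) :=
    sqrt_le_sqrt (le_mul_of_one_le_left v.2 (by linarith [pi_gt_three]))
  rw [gaussianPDFReal_def]
  calc (√(2 * π * v))⁻¹ * exp (-(x - m) ^ 2 / (2 * v)) * √v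
      ≤ (√v)⁻¹ * 1 * √v := by gcongr
    _ = 1 := by field_simp

/-- A Gaussian law with standard deviation `s` gives an interval of length `ε` mass at most
`ε / s`. -/
lemma gaussianReal_real_Icc_mul_sqrt_le (m : ℝ) (v : NNReal) (a : ℝ) {ε : ℝ} (hε : 0 ≤ ε) :
    (gaussianReal m v).real (Set.Icc a (a + ε)) * √v ≤ ε := by
  rcases eq_or_ne v 0 with rfl | hv
  · simpa using hε
  have hv' : 0 < √(v : ℝ) := sqrt_pos.2 (by positivity)
  have hle : gaussianReal m v (Set.Icc a (a + ε)) ≤ ENNReal.ofReal (1 / √v * ε) := by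
    rw [gaussianReal_apply m hv]
    calc ∫⁻ x in Set.Icc a (a + ε), gaussianPDF m v x
        ≤ ∫⁻ _ in Set.Icc a (a + ε), ENNReal.ofReal (1 / √v) := by
          refine lintegral_mono fun x => ENNReal.ofReal_le_ofReal ?_
          exact (le_div_iff₀ hv').2 (gaussianPDFReal_mul_sqrt_le_one m v x)
      _ = ENNReal.ofReal (1 / √v * ε) := by
          rw [setLIntegral_const, Real.volume_Icc, add_sub_cancel_left,
            ENNReal.ofReal_mul (by positivity)]
  have hreal : (gaussianReal m v).real (Set.Icc a (a + ε)) ≤ 1 / √v * ε :=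
    ENNReal.toReal_le_of_le_ofReal (by positivity) hle
  calc (gaussianReal m v).real (Set.Icc a (a + ε)) * √v ≤ 1 / √v * ε * √v := by gcongr
    _ = ε := by field_simp

lemma measureReal_mul_le_of_hasGaussianLaw {Ω : Type*} [MeasurableSpace Ω] {P : Measure Ω}
    {Y : Ω → ℝ} (hY : HasGaussianLaw Y P) {s : ℝ} (hs : 0 ≤ s) (hvar : Var[Y; P] = s ^ 2)
    (a : ℝ) {ε : ℝ} (hε : 0 ≤ ε) :
    P.real {ω | a ≤ Y ω ∧ Y ω ≤ a + ε} * s ≤ ε := by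
  have h := gaussianReal_real_Icc_mul_sqrt_le (∫ ω, Y ω ∂P) (Var[Y; P]).toNNReal a hε
  rw [← hY.map_eq_gaussianReal, Real.coe_toNNReal _ (variance_nonneg Y P), hvar, sqrt_sq hs,
    measureReal_def, Measure.map_apply_of_aemeasurable hY.aemeasurable measurableSet_Icc] at h
  exact h

end GaussianAntiConcentration

theorem mainTheorem12 {Ω : Type*} [MeasurableSpace Ω] (P : Measure Ω) [IsProbabilityMeasure P]
    (n : ℕ) [NeZero n] (X : Fin n → Ω → ℝ) (hX : IsGaussianProcess X P)
    (σ : Fin n → ℝ) (hσ : ∀ i, 0 ≤ σ i) (hvar : ∀ i, Var[X i; P] = σ i ^ 2) :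
    GaussianAntiConcentration.orderStat σ 0 ≤ GaussianAntiConcentration.sigmaBar σ ∧
    ∀ (x : Fin n → ℝ) (ε : ℝ), 0 < ε →
      P.real {ω | ∀ i, x i ≤ X i ω ∧ X i ω ≤ x i + ε} ≤
        12 * GaussianAntiConcentration.logFactor n * ε /
          √(GaussianAntiConcentration.sigmaBar σ ^ 2 +
            GaussianAntiConcentration.logFactor n ^ 2 * ε ^ 2) := by
  refine ⟨GaussianAntiConcentration.orderStat_zero_le_sigmaBar hσ, fun x ε hε => ?_⟩
  set S := GaussianAntiConcentration.sigmaBar σ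
  set L := GaussianAntiConcentration.logFactor n
  set p := P.real {ω | ∀ i, x i ≤ X i ω ∧ X i ω ≤ x i + ε}
  have hp0 : 0 ≤ p := measureReal_nonneg
  have hp1 : p ≤ 1 := measureReal_le_one
  have hL := GaussianAntiConcentration.two_le_logFactor n
  have hbar : 0 ≤ S :=
    (hσ _).trans (GaussianAntiConcentration.orderStat_zero_le_sigmaBar hσ)
  have hLε : 0 < L * ε := by positivity
  have hpσ : p * S ≤ ε := by
    -- A coordinate with `σ i = σ₍ₙ₎`; ranks are zero-based.
    let i := Tuple.sort σ ⟨n - 1, Nat.sub_one_lt (NeZero.ne n)⟩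
    calc p * S
        ≤ P.real {ω | x i ≤ X i ω ∧ X i ω ≤ x i + ε} * σ i :=
          mul_le_mul (measureReal_mono fun ω hω => hω i)
            (GaussianAntiConcentration.sigmaBar_le_topOrderStat hσ) hbar measureReal_nonneg
      _ ≤ ε := GaussianAntiConcentration.measureReal_mul_le_of_hasGaussianLaw
          (hX.hasGaussianLaw_eval i) (hσ i) (hvar i) (x i) hε.le
  have hsqrt : √(S ^ 2 + L ^ 2 * ε ^ 2) ≤ S + L * ε :=
    Real.sqrt_le_iff.2 ⟨by positivity, by nlinarith⟩
  rw [le_div_iff₀ (Real.sqrt_pos.2 (by positivity))]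
  calc p * √(S ^ 2 + L ^ 2 * ε ^ 2)
      ≤ p * S + p * (L * ε) := by
        rw [← mul_add]; gcongr
    _ ≤ ε + 1 * (L * ε) := by gcongr
    -- As `L ≥ 2`, the left side is at most `(3 / 2) * L * ε`, so 12 is far from tight.
    _ ≤ 12 * L * ε := by nlinarith
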